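/- Let $K$ be a quadratic number field with field embeddings $\sigma_\infty:K\to\mathbb{R}$ and $\sigma_2:K\to\mathbb{Q}_2$; write $\alpha_\infty=\sigma_\infty(\alpha)$ and $\alpha_{\langle 2\rangle}=\sigma_2(\alpha)$. For $u=\sum_n c_n2^n\in\mathbb{Q}_2$ with $c_n\in\{0,1\}$, put $\lfloor u\rfloor_2=\sum_{n\le 0}c_n2^n\in\mathbb{Z}[\tfrac12]$. For $\alpha\in K$ define $$b^{(0)}(\alpha)=2m_0+\lfloor\alpha_{\langle 2\rangle}\rfloor_2,\qquad b^{(1)}(\alpha)=m_1+\lfloor\alpha_{\langle 2\rangle}\rfloor_2,$$ where $m_0$ (respectively $m_1$) is the smallest integer $i$ among those minimising $|\alpha_\infty-2i-\lfloor\alpha_{\langle 2\rangle}\rfloor_2|$ (respectively $|\alpha_\infty-i-\lfloor\alpha_{\langle 2\rangle}\rfloor_2|$). Write $\tau(n)\in\{0,1\}$ for the residue of $n$ modulo $2$. Algorithm 1. Given $\alpha\in K$, put $\alpha_0=\alpha$, $b_n=b^{(\tau(n))}(\alpha_n)$ and $\alpha_{n+1}=1/(\alpha_n-b_n)$; the algorithm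 halts after producing $b_0,\dots,b_N$ if $\alpha_N=b_N$. Its convergents $p_n/q_n$ are given by $$\begin{pmatrix}p_n&p_{n-1}\\ q_n&q_{n-1}\end{pmatrix}=\begin{pmatrix}b_0&1\\1&0\end{pmatrix}\cdots\begin{pmatrix}b_n&1\\1&0\end{pmatrix},\qquad p_{-1}=1,\ q_{-1}=0.$$ Algorithm 2. Given $\alpha\in K$, put $\alpha_{(1)}=\alpha$ and, as long as $\alpha_{(n)}\neq 0$, $a_n=b^{(\tau(n))}(1/\alpha_{(n)})$ and $\alpha_{(n+1)}=1/\alpha_{(n)}-a_n$; the algorithm terminates if $\alpha_{(n)}=0$. Its convergents $p_n/q_n$ are given by $$\begin{pmatrix}p_{n-1}&p_n\\ q_{n-1}&q_n\end{pmatrix}=\begin{pmatrix}0&1\\1&a_1\end{pmatrix}\cdots\begin{pmatrix}0&1\\1&a_n\end{pmatrix},\qquad p_0=0,\ q_0=1.$$ An element $\alpha\in K$ has property $I$ if $\alpha_\infty\in(-1,1]$ and $v_2(\alpha_{\langle 2\rangle})>0$ (where $v_2(0)=\infty$). Theorem. 1. Let $\alpha\in K\setminus\mathbb{Q}$ have property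 $I$. Then Algorithm 2 applied to $\alpha$ never terminates, $q_n\neq 0$ for all $n\ge 0$, and its convergents satisfy $\lim_{n\to\infty}p_n/q_n=\alpha_\infty$ in $\mathbb{R}$. 2. Let $\alpha\in K\setminus\mathbb{Q}$. Then Algorithm 1 applied to $\alpha$ never halts, $q_n\neq 0$ for all $n\ge 0$, and its convergents satisfy $\lim_{n\to\infty}p_n/q_n=\alpha_\infty$ in $\mathbb{R}$. 3. Let $\alpha\in\mathbb{Q}\subset K$. Then Algorithm 1 applied to $\alpha$ halts after producing finitely many terms $b_0,\dots,b_N$, $q_n\neq 0$ for $0\le n\le N$, and the last convergent satisfies $p_N/q_N=\alpha_\infty$. -/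

import Mathlib

open Filter Topology

/-- Multiplying a `p`-adic number by `p ^ k`, where `k = max (-v_p(u)) 0`, gives a `p`-adic integer. -/
theorem norm_prime_pow_mul_le_one {p : ℕ} [Fact p.Prime] (u : ℚ_[p]) :
    ‖(p : ℚ_[p]) ^ (-u.valuation).toNat * u‖ ≤ 1 := by
  have hp : (1 : ℝ) < p := by exact_mod_cast (Fact.out : p.Prime).one_lt
  by_cases hu : u = 0
  · simp [hu]
  · rw [norm_mul, norm_pow, Padic.norm_p, Padic.norm_eq_zpow_neg_valuation hu, inv_pow,
      ← zpow_natCast, ← zpow_neg, ← zpow_add₀ (by positivity)]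
    exact zpow_le_one_of_nonpos₀ hp.le (by omega)

/-- The `p`-adic floor `⌊u⌋_p = ∑_{n ≤ 0} c_n p ^ n` of `u = ∑_n c_n p ^ n`, with digits
`c_n ∈ {0, …, p - 1}`. With `k = max (-v_p(u)) 0`, the number `p ^ k * u` is a `p`-adic integer and
`PadicInt.appr _ (k + 1)` is the sum of the first `k + 1` terms of its digit expansion
(the residue in `[0, p ^ (k + 1))` modulo `p ^ (k + 1)`); dividing by `p ^ k` gives the sum over
the exponents `-k, …, 0`. -/
noncomputable def padicFloor {p : ℕ} [Fact p.Prime] (u : ℚ_[p]) : ℚ :=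
  (PadicInt.appr
      (⟨(p : ℚ_[p]) ^ (-u.valuation).toNat * u, norm_prime_pow_mul_le_one u⟩ : ℤ_[p])
      ((-u.valuation).toNat + 1) : ℚ) / (p : ℚ) ^ (-u.valuation).toNat

/-- The smallest integer `i` among those for which `|x - i * s|` attains its minimum
(used for `s ≥ 1`). -/
noncomputable def nearestIndex (s : ℕ) (x : ℝ) : ℤ :=
  sInf {i : ℤ | ∀ j : ℤ, |x - i * s| ≤ |x - j * s|}

section Algorithms

variable {p : ℕ} [Fact p.Prime] {K : Type*} [Field K]

/-- `m * s + ⌊α_⟨p⟩⌋_p`, where `m` is the smallest integer `i` minimising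
`|α_∞ - i * s - ⌊α_⟨p⟩⌋_p|`. This is `b^(0)(α)` for `s = p` and `b^(1)(α)` for `s = 1`. -/
noncomputable def bApprox (σinf : K →+* ℝ) (σp : K →+* ℚ_[p]) (s : ℕ) (α : K) : ℚ :=
  nearestIndex s (σinf α - (padicFloor (σp α) : ℝ)) * s + padicFloor (σp α)

/-- `p` at even indices and `1` at odd indices. -/
def spacing (p n : ℕ) : ℕ := if Even n then p else 1

/-- The complete quotients `α_0 = α`, `α_{n+1} = 1 / (α_n - b_n(α))` of Algorithm 1. The algorithm
halts at the first `n` with `α_n = b_n(α)`; the values after that are meaningless. -/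
noncomputable def alg1Seq (σinf : K →+* ℝ) (σp : K →+* ℚ_[p]) (α : K) : ℕ → K
  | 0 => α
  | n + 1 => 1 / (alg1Seq σinf σp α n -
      (bApprox σinf σp (spacing p n) (alg1Seq σinf σp α n) : K))

/-- The partial quotients `b_n(α)` of Algorithm 1: `b^(0)(α_n)` for even `n` and `b^(1)(α_n)` for
odd `n`. -/
noncomputable def alg1Quot (σinf : K →+* ℝ) (σp : K →+* ℚ_[p]) (α : K) (n : ℕ) : ℚ :=
  bApprox σinf σp (spacing p n) (alg1Seq σinf σp α n)

/-- Algorithm 1 never halts on `α`. -/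
def Alg1Infinite (σinf : K →+* ℝ) (σp : K →+* ℚ_[p]) (α : K) : Prop :=
  ∀ n, alg1Seq σinf σp α n ≠ (alg1Quot σinf σp α n : K)

/-- Algorithm 1 halts on `α` after producing exactly `b_0(α), …, b_N(α)`. -/
def Alg1HaltsAt (σinf : K →+* ℝ) (σp : K →+* ℚ_[p]) (α : K) (N : ℕ) : Prop :=
  (∀ n < N, alg1Seq σinf σp α n ≠ (alg1Quot σinf σp α n : K)) ∧
    alg1Seq σinf σp α N = (alg1Quot σinf σp α N : K)

/-- `[[b_0, 1], [1, 0]] * ⋯ * [[b_n, 1], [1, 0]] = [[p_n, p_{n-1}], [q_n, q_{n-1}]]`. -/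
def convMatrix1 (b : ℕ → ℚ) : ℕ → Matrix (Fin 2) (Fin 2) ℚ
  | 0 => !![b 0, 1; 1, 0]
  | n + 1 => convMatrix1 b n * !![b (n + 1), 1; 1, 0]

/-- The numerator `p_n` of the `n`-th convergent of Algorithm 1. -/
noncomputable def alg1Num (σinf : K →+* ℝ) (σp : K →+* ℚ_[p]) (α : K) (n : ℕ) : ℚ :=
  convMatrix1 (alg1Quot σinf σp α) n 0 0

/-- The denominator `q_n` of the `n`-th convergent of Algorithm 1. -/
noncomputable def alg1Den (σinf : K →+* ℝ) (σp : K →+* ℚ_[p]) (α : K) (n : ℕ) : ℚ :=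
  convMatrix1 (alg1Quot σinf σp α) n 1 0

/-- Property `I`: `α_∞ ∈ (-p/2, p/2]` and `v_p(α_⟨p⟩) > 0` (with `v_p(0) = ∞`). -/
def PropertyI (σinf : K →+* ℝ) (σp : K →+* ℚ_[p]) (α : K) : Prop :=
  σinf α ∈ Set.Ioc (-(p : ℝ) / 2) ((p : ℝ) / 2) ∧ 0 < Padic.addValuation (σp α)

/-- The sequence `α_(1) = α`, `α_(n+1) = T_{p,ε}(α_(n)) = 1 / α_(n) - a^(ε)(α_(n))` of Algorithm 2,
with `ε ≡ n` modulo `2` and `a^(ε)(x) = b^(ε)(1 / x)`. The algorithm terminates at the first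
`n ≥ 1` with `α_(n) = 0`; the values after that, and the value at index `0`, are meaningless. -/
noncomputable def alg2Seq (σinf : K →+* ℝ) (σp : K →+* ℚ_[p]) (α : K) : ℕ → K
  | 0 => α
  | 1 => α
  | n + 2 => 1 / alg2Seq σinf σp α (n + 1) -
      (bApprox σinf σp (spacing p (n + 1)) (1 / alg2Seq σinf σp α (n + 1)) : K)

/-- The partial quotients `a_n(α)`, `n ≥ 1`, of Algorithm 2. -/
noncomputable def alg2Quot (σinf : K →+* ℝ) (σp : K →+* ℚ_[p]) (α : K) (n : ℕ) : ℚ :=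
  bApprox σinf σp (spacing p n) (1 / alg2Seq σinf σp α n)

/-- `[[0, 1], [1, a_1]] * ⋯ * [[0, 1], [1, a_n]] = [[p_{n-1}, p_n], [q_{n-1}, q_n]]`
(the identity matrix for `n = 0`, so that `p_0 = 0` and `q_0 = 1`). -/
def convMatrix2 (a : ℕ → ℚ) : ℕ → Matrix (Fin 2) (Fin 2) ℚ
  | 0 => 1
  | n + 1 => convMatrix2 a n * !![0, 1; 1, a (n + 1)]

/-- The numerator `p_n` of the `n`-th convergent of Algorithm 2. -/
noncomputable def alg2Num (σinf : K →+* ℝ) (σp : K →+* ℚ_[p]) (α : K) (n : ℕ) : ℚ :=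
  convMatrix2 (alg2Quot σinf σp α) n 0 1

/-- The denominator `q_n` of the `n`-th convergent of Algorithm 2. -/
noncomputable def alg2Den (σinf : K →+* ℝ) (σp : K →+* ℚ_[p]) (α : K) (n : ℕ) : ℚ :=
  convMatrix2 (alg2Quot σinf σp α) n 1 1

end Algorithms

/-!
Real convergence and termination have different causes.

Let `z_n` be the real complete quotients, so that `z_n = b_n + 1 / z_{n+1}`, and put
`A_n = z_1 ⋯ z_n`. The remainders satisfy `|z_n - b_n| ≤ 1` for even `n` and `|z_n - b_n| ≤ 1 / 2`
for odd `n`, hence `|z_n z_{n+1}| ≥ 2` for `n ≥ 1`. As the partial quotients may be small and of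
either sign, the denominators `q_n` need not grow; instead one follows `W_n = q_n A_{n+1}`.
From `q_n z_{n+1} + q_{n-1} = A_{n+1}` (`cfDen_mul_add`) one gets `W_n + W_{n-1} = B_n` with
`B_n = A_n A_{n+1}` (`cfDen_mul_prod_add`), where `|B_{n+1}| ≥ 2 |B_n|`. This alone forces
`|W_n| ≥ |B_0| > 0`, whence `q_n ≠ 0`, and `|W_n| → ∞` (`tendsto_abs_atTop_of_add_eq`). Since
`z_0 - p_n / q_n = ± 1 / W_n`, the convergents tend to `z_0`. Algorithm 2 is covered by
taking `b_0 = 0`, `z_0 = α_∞` and `z_n = 1 / α_(n)`. Neither algorithm stops on an irrational `α`,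
because the complete quotients stay irrational.

Termination on rational numbers is where the `2`-adic digits enter: the remainder `r` of a step
satisfies `|r|_∞ |r|_2 ≤ 1 / 2`, and by the product formula this makes the odd part of the
denominator of the complete quotient decrease strictly (`exists_lt_mul_pow_mul_inv_eq_int`).
-/

/-! ### Sequences with `W (n + 1) + W n = B (n + 1)` -/

theorem abs_le_of_add_eq {B W : ℕ → ℝ} {m N : ℕ} (hm : |W m| ≤ |B m|)
    (hB : ∀ n, m ≤ n → n < N → 2 * |B n| ≤ |B (n + 1)|)
    (hW : ∀ n, m ≤ n → n < N → W (n + 1) + W n = B (n + 1)) (n : ℕ) (hmn : m ≤ n) (hn : n ≤ N) :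
    |W n| ≤ 2 * |B n| - |B m| := by
  induction n, hmn using Nat.le_induction with
  | base => linarith
  | succ n hmn ih =>
    have h1 := ih (by omega)
    have h2 := hB n hmn (by omega)
    have h3 : |W (n + 1)| ≤ |B (n + 1)| + |W n| := by
      rw [show W (n + 1) = B (n + 1) - W n by linarith [hW n hmn (by omega)]]
      exact abs_sub _ _
    linarith

/-- As soon as `|W m| ≤ |B m|`, every later `|W n|` is at least `|B m|`: the inequality
`|W (n + 1)| ≥ |B (n + 1)| - |W n|` is combined with the upper bound above. -/
theorem abs_le_abs_of_add_eq {B W : ℕ → ℝ} {m N : ℕ} (hm : |W m| ≤ |B m|)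
    (hB : ∀ n, m ≤ n → n < N → 2 * |B n| ≤ |B (n + 1)|)
    (hW : ∀ n, m ≤ n → n < N → W (n + 1) + W n = B (n + 1)) (n : ℕ) (hmn : m ≤ n) (hn : n < N) :
    |B m| ≤ |W (n + 1)| := by
  have h1 := abs_le_of_add_eq hm hB hW n hmn hn.le
  have h2 := hB n hmn hn
  have h3 : |B (n + 1)| ≤ |W (n + 1)| + |W n| := by
    rw [← hW n hmn hn]
    exact abs_add_le _ _
  linarith

/-- If `|W n| ≥ |B n|` for all large `n`, this is clear. Otherwise `|W m| ≤ |B m|` for some `m` with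
`|B m|` as large as desired, and `|B m|` bounds every later `|W n|` from below. -/
theorem tendsto_abs_atTop_of_add_eq {B W : ℕ → ℝ} (hB0 : B 0 ≠ 0)
    (hB : ∀ n, 2 * |B n| ≤ |B (n + 1)|) (hW : ∀ n, W (n + 1) + W n = B (n + 1)) :
    Tendsto (fun n => |W n|) atTop atTop := by
  have hpow : ∀ n, |B 0| * 2 ^ n ≤ |B n| := by
    intro n
    induction n with
    | zero => simp
    | succ n ih => rw [pow_succ]; linarith [hB n]
  have hBtop : Tendsto (fun n => |B n|) atTop atTop :=
    tendsto_atTop_mono hpow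
      ((tendsto_pow_atTop_atTop_of_one_lt one_lt_two).const_mul_atTop (abs_pos.2 hB0))
  by_cases h : ∀ᶠ n in atTop, |B n| ≤ |W n|
  · exact tendsto_atTop_mono' _ h hBtop
  · rw [tendsto_atTop]
    intro C
    obtain ⟨m, hm, hC⟩ :=
      ((not_eventually.1 h).and_eventually (hBtop.eventually_ge_atTop C)).exists
    filter_upwards [eventually_gt_atTop m] with n hn
    obtain ⟨k, rfl⟩ := Nat.exists_eq_add_one_of_ne_zero (Nat.ne_zero_of_lt hn)
    exact hC.trans (abs_le_abs_of_add_eq (N := k + 1) (not_le.1 hm).le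
      (fun n _ _ => hB n) (fun n _ _ => hW n) k (by omega) (by omega))

/-! ### Continued fractions with rational partial quotients -/

/-- The numerators of the convergents of `b 0 + 1 / (b 1 + 1 / (b 2 + ⋯))`, with the index shifted
by one: `cfNum b (n + 1)` is `p_n` and `cfNum b 0` is `p_{-1} = 1`. -/
def cfNum (b : ℕ → ℚ) : ℕ → ℚ
  | 0 => 1
  | 1 => b 0
  | n + 2 => b (n + 1) * cfNum b (n + 1) + cfNum b n

/-- The denominators of the convergents of `b 0 + 1 / (b 1 + 1 / (b 2 + ⋯))`, with the index shifted
by one: `cfDen b (n + 1)` is `q_n` and `cfDen b 0` is `q_{-1} = 0`. -/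
def cfDen (b : ℕ → ℚ) : ℕ → ℚ
  | 0 => 0
  | 1 => 1
  | n + 2 => b (n + 1) * cfDen b (n + 1) + cfDen b n

theorem convMatrix1_eq (b : ℕ → ℚ) (n : ℕ) :
    convMatrix1 b n = !![cfNum b (n + 1), cfNum b n; cfDen b (n + 1), cfDen b n] := by
  induction n with
  | zero => simp [convMatrix1, cfNum, cfDen]
  | succ n ih =>
    rw [convMatrix1, ih, Matrix.mul_fin_two]
    simp [cfNum, cfDen, mul_comm]

/-- The convergents of Algorithm 2 are those of a continued fraction whose term of index `0`
vanishes. -/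
theorem convMatrix2_eq (a : ℕ → ℚ) (n : ℕ) :
    convMatrix2 a n = !![cfNum (Function.update a 0 0) n, cfNum (Function.update a 0 0) (n + 1);
      cfDen (Function.update a 0 0) n, cfDen (Function.update a 0 0) (n + 1)] := by
  induction n with
  | zero => simp [convMatrix2, cfNum, cfDen, Matrix.one_fin_two]
  | succ n ih =>
    rw [convMatrix2, ih, Matrix.mul_fin_two]
    simp [cfNum, cfDen, mul_comm, add_comm]

section Convergents

variable {p : ℕ} [Fact p.Prime] {K : Type*} [Field K] (σinf : K →+* ℝ) (σp : K →+* ℚ_[p])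

theorem alg1Den_eq (α : K) (n : ℕ) :
    alg1Den σinf σp α n = cfDen (alg1Quot σinf σp α) (n + 1) := by
  simp [alg1Den, convMatrix1_eq]

theorem alg1Num_eq (α : K) (n : ℕ) :
    alg1Num σinf σp α n = cfNum (alg1Quot σinf σp α) (n + 1) := by
  simp [alg1Num, convMatrix1_eq]

theorem alg2Den_eq (α : K) (n : ℕ) :
    alg2Den σinf σp α n = cfDen (Function.update (alg2Quot σinf σp α) 0 0) (n + 1) := by
  simp [alg2Den, convMatrix2_eq]

theorem alg2Num_eq (α : K) (n : ℕ) :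
    alg2Num σinf σp α n = cfNum (Function.update (alg2Quot σinf σp α) 0 0) (n + 1) := by
  simp [alg2Num, convMatrix2_eq]

end Convergents

/-- The complete quotients `z` turn a solution `X` of the three-term recurrence of the convergents
into one of a first-order recurrence. -/
theorem recurrence_mul_add {z X : ℕ → ℝ} {b : ℕ → ℚ} {N : ℕ}
    (hz : ∀ n < N, z (n + 1) * (z n - b n) = 1)
    (hX : ∀ n, X (n + 2) = b (n + 1) * X (n + 1) + X n) (n : ℕ) (hn : n < N) :
    X (n + 1) * z (n + 1) + X n = (X 1 * z 1 + X 0) * ∏ i ∈ Finset.range n, z (i + 2) := by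
  induction n with
  | zero => simp
  | succ n ih =>
    rw [Finset.prod_range_succ, ← mul_assoc, ← ih (by omega), hX]
    linear_combination (-X (n + 1)) * hz (n + 1) hn

theorem cfDen_mul_add {z : ℕ → ℝ} {b : ℕ → ℚ} {N : ℕ}
    (hz : ∀ n < N, z (n + 1) * (z n - b n) = 1) (n : ℕ) (hn : n < N) :
    cfDen b (n + 1) * z (n + 1) + cfDen b n = ∏ i ∈ Finset.range (n + 1), z (i + 1) := by
  rw [recurrence_mul_add (X := fun n => (cfDen b n : ℝ)) hz (fun n => by simp [cfDen]) n hn,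
    Finset.prod_range_succ', mul_comm]
  simp [cfDen]

theorem cf_error_mul_add {z : ℕ → ℝ} {b : ℕ → ℚ} {N : ℕ}
    (hz : ∀ n < N, z (n + 1) * (z n - b n) = 1) (n : ℕ) (hn : n < N) :
    (cfDen b (n + 1) * z 0 - cfNum b (n + 1)) * z (n + 1) + (cfDen b n * z 0 - cfNum b n) = 0 := by
  rw [recurrence_mul_add (X := fun n => (cfDen b n * z 0 - cfNum b n : ℝ)) hz
    (fun n => by simp [cfDen, cfNum]; ring) n hn]
  have h := hz 0 (by omega)
  simp only [zero_add] at h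
  simp only [cfDen, cfNum]
  push_cast
  rw [show (1 * z 0 - b 0) * z 1 + (0 * z 0 - 1) = z 1 * (z 0 - b 0) - 1 by ring, h]
  simp

theorem cf_error_mul_prod {z : ℕ → ℝ} {b : ℕ → ℚ} {N : ℕ}
    (hz : ∀ n < N, z (n + 1) * (z n - b n) = 1) (n : ℕ) (hn : n ≤ N) :
    (cfDen b n * z 0 - cfNum b n) * ∏ i ∈ Finset.range n, z (i + 1) = -(-1) ^ n := by
  induction n with
  | zero => simp [cfDen, cfNum]
  | succ n ih =>
    have h := cf_error_mul_add hz n hn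
    rw [Finset.prod_range_succ]
    linear_combination (∏ i ∈ Finset.range n, z (i + 1)) * h - ih (by omega)

theorem prod_complete_ne_zero {z : ℕ → ℝ} {b : ℕ → ℚ} {N : ℕ}
    (hz : ∀ n < N, z (n + 1) * (z n - b n) = 1) (n : ℕ) (hn : n ≤ N) :
    ∏ i ∈ Finset.range n, z (i + 1) ≠ 0 := by
  refine Finset.prod_ne_zero_iff.2 fun i hi h => ?_
  have := hz i (by have := Finset.mem_range.1 hi; omega)
  simp [h] at this

/-- The relation `W (n + 1) + W n = B (n + 1)` for `W n = q_n z_1 ⋯ z_{n+1}` and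
`B n = (z_1 ⋯ z_n) (z_1 ⋯ z_{n+1})`. -/
theorem cfDen_mul_prod_add {z : ℕ → ℝ} {b : ℕ → ℚ} {N : ℕ}
    (hz : ∀ n < N, z (n + 1) * (z n - b n) = 1) (n : ℕ) (hn : n + 1 < N) :
    cfDen b (n + 2) * ∏ i ∈ Finset.range (n + 2), z (i + 1) +
        cfDen b (n + 1) * ∏ i ∈ Finset.range (n + 1), z (i + 1) =
      (∏ i ∈ Finset.range (n + 1), z (i + 1)) * ∏ i ∈ Finset.range (n + 2), z (i + 1) := by
  rw [← cfDen_mul_add hz (n + 1) hn, cfDen_mul_add hz (n + 1) hn,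
    Finset.prod_range_succ _ (n + 1)]
  have h := cfDen_mul_add hz (n + 1) hn
  rw [Finset.prod_range_succ _ (n + 1)] at h
  linear_combination (∏ i ∈ Finset.range (n + 1), z (i + 1)) * h

theorem two_mul_abs_prod_le {z : ℕ → ℝ} {n : ℕ} (hc : 2 ≤ |z (n + 1) * z (n + 2)|) :
    2 * |(∏ i ∈ Finset.range n, z (i + 1)) * ∏ i ∈ Finset.range (n + 1), z (i + 1)| ≤
      |(∏ i ∈ Finset.range (n + 1), z (i + 1)) * ∏ i ∈ Finset.range (n + 2), z (i + 1)| := by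
  have h : (∏ i ∈ Finset.range (n + 1), z (i + 1)) * ∏ i ∈ Finset.range (n + 2), z (i + 1) =
      z (n + 1) * z (n + 2) *
        ((∏ i ∈ Finset.range n, z (i + 1)) * ∏ i ∈ Finset.range (n + 1), z (i + 1)) := by
    rw [Finset.prod_range_succ _ (n + 1), Finset.prod_range_succ _ n]
    ring
  rw [h, abs_mul (z (n + 1) * z (n + 2))]
  exact mul_le_mul_of_nonneg_right hc (abs_nonneg _)

theorem cfDen_ne_zero {z : ℕ → ℝ} {b : ℕ → ℚ} {N : ℕ}
    (hz : ∀ n < N, z (n + 1) * (z n - b n) = 1)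
    (hc : ∀ n, n + 1 < N → 2 ≤ |z (n + 1) * z (n + 2)|) (n : ℕ) (hn : n < N) :
    cfDen b (n + 1) ≠ 0 := by
  cases n with
  | zero => simp [cfDen]
  | succ n =>
    intro h0
    have h := abs_le_abs_of_add_eq (m := 0) (N := n + 1)
      (B := fun n => (∏ i ∈ Finset.range n, z (i + 1)) * ∏ i ∈ Finset.range (n + 1), z (i + 1))
      (W := fun n => cfDen b (n + 1) * ∏ i ∈ Finset.range (n + 1), z (i + 1))
      (by simp [cfDen])
      (fun k _ hk => two_mul_abs_prod_le (hc k (by omega)))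
      (fun k _ hk => cfDen_mul_prod_add hz k (by omega)) n (by omega) (by omega)
    simp only [h0, Rat.cast_zero, zero_mul, abs_zero, Finset.range_zero, Finset.prod_empty,
      one_mul] at h
    exact prod_complete_ne_zero hz 1 (by omega) (abs_nonpos_iff.1 h)

theorem tendsto_cf_convergents {z : ℕ → ℝ} {b : ℕ → ℚ}
    (hz : ∀ n, z (n + 1) * (z n - b n) = 1) (hc : ∀ n, 2 ≤ |z (n + 1) * z (n + 2)|) :
    Tendsto (fun n => ((cfNum b (n + 1) / cfDen b (n + 1) : ℚ) : ℝ)) atTop (𝓝 (z 0)) := by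
  have hz' : ∀ N, ∀ n < N, z (n + 1) * (z n - b n) = 1 := fun N n _ => hz n
  have hW := tendsto_abs_atTop_of_add_eq
    (B := fun n => (∏ i ∈ Finset.range n, z (i + 1)) * ∏ i ∈ Finset.range (n + 1), z (i + 1))
    (W := fun n => cfDen b (n + 1) * ∏ i ∈ Finset.range (n + 1), z (i + 1))
    (mul_ne_zero (prod_complete_ne_zero (hz' 0) 0 le_rfl) (prod_complete_ne_zero (hz' 1) 1 le_rfl))
    (fun k => two_mul_abs_prod_le (hc k))
    (fun k => cfDen_mul_prod_add (hz' (k + 2)) k (by omega))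
  rw [tendsto_iff_norm_sub_tendsto_zero]
  refine hW.inv_tendsto_atTop.congr fun n => ?_
  have hq : (cfDen b (n + 1) : ℝ) ≠ 0 :=
    Rat.cast_ne_zero.2 (cfDen_ne_zero (hz' (n + 1)) (fun k _ => hc k) n (by omega))
  have hA := prod_complete_ne_zero (hz' (n + 1)) (n + 1) le_rfl
  have hE := cf_error_mul_prod (hz' (n + 1)) (n + 1) le_rfl
  set A := ∏ i ∈ Finset.range (n + 1), z (i + 1)
  have h : ((cfNum b (n + 1) / cfDen b (n + 1) : ℚ) : ℝ) - z 0 =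
      (-1) ^ (n + 1) * (cfDen b (n + 1) * A)⁻¹ := by
    push_cast
    field_simp
    linear_combination -hE
  rw [h, Pi.inv_apply, Real.norm_eq_abs, abs_mul ((-1) ^ (n + 1)), abs_pow, abs_neg, abs_one,
    one_pow, one_mul, abs_inv]

/-- A continued fraction that stops at index `N` represents its value. -/
theorem cf_finite {z : ℕ → ℝ} {b : ℕ → ℚ} {N : ℕ}
    (hz : ∀ n < N, z (n + 1) * (z n - b n) = 1) (hN : z N = b N) :
    cfDen b (N + 1) ≠ 0 ∧ ((cfNum b (N + 1) / cfDen b (N + 1) : ℚ) : ℝ) = z 0 := by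
  cases N with
  | zero => simp [cfDen, cfNum, hN]
  | succ N =>
    have hD : (cfDen b (N + 2) : ℝ) ≠ 0 := by
      have h := cfDen_mul_add hz N (by omega)
      rw [show (cfDen b (N + 2) : ℝ) = cfDen b (N + 1) * z (N + 1) + cfDen b N by
        rw [hN, cfDen]; push_cast; ring, h]
      exact prod_complete_ne_zero hz (N + 1) le_rfl
    refine ⟨Rat.cast_ne_zero.1 hD, ?_⟩
    have h := cf_error_mul_add hz N (by omega)
    rw [hN] at h
    rw [Rat.cast_div, div_eq_iff hD, cfDen, cfNum]
    push_cast
    linear_combination -h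

/-! ### The approximations `bApprox` -/

theorem nearestIndex_spec {s : ℕ} (hs : 0 < s) (x : ℝ) (j : ℤ) :
    |x - nearestIndex s x * s| ≤ |x - j * s| := by
  have hs' : (0 : ℝ) < s := by exact_mod_cast hs
  have key : ∀ i : ℤ, |x - i * s| = |x / s - i| * s := by
    intro i
    rw [← abs_of_pos hs', ← abs_mul, abs_of_pos hs']
    congr 1
    field_simp
  have hne : {i : ℤ | ∀ j : ℤ, |x - i * s| ≤ |x - j * s|}.Nonempty := by
    refine ⟨round (x / s), fun j => ?_⟩
    rw [key, key]
    exact mul_le_mul_of_nonneg_right (round_le _ _) hs'.le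
  have hbdd : BddBelow {i : ℤ | ∀ j : ℤ, |x - i * s| ≤ |x - j * s|} := by
    refine ⟨⌊x / s - |x / s|⌋, fun i hi => ?_⟩
    have h := hi 0
    rw [key, key] at h
    have h2 := le_of_mul_le_mul_right h hs'
    simp only [Int.cast_zero, sub_zero] at h2
    have h3 := (abs_le.1 h2).2
    exact Int.cast_le.1 ((Int.floor_le (x / s - |x / s|)).trans (by linarith) :
      ((⌊x / s - |x / s|⌋ : ℤ) : ℝ) ≤ i)
  exact Int.csInf_mem hne hbdd j

theorem abs_sub_nearestIndex_mul_le {s : ℕ} (hs : 0 < s) (x : ℝ) :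
    |x - nearestIndex s x * s| ≤ s / 2 := by
  have h1 := nearestIndex_spec hs x (nearestIndex s x + 1)
  have h2 := nearestIndex_spec hs x (nearestIndex s x - 1)
  push_cast at h1 h2
  have hs' : (0 : ℝ) < s := by exact_mod_cast hs
  set y := x - nearestIndex s x * s with hy
  rw [show x - (nearestIndex s x + 1) * s = y - s by rw [hy]; ring] at h1
  rw [show x - (nearestIndex s x - 1) * s = y + s by rw [hy]; ring] at h2
  have h1' := sq_le_sq.2 h1
  have h2' := sq_le_sq.2 h2
  rw [abs_le]
  constructor <;> nlinarith

theorem norm_sub_padicFloor_le {p : ℕ} [hp : Fact p.Prime] (u : ℚ_[p]) :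
    ‖u - (padicFloor u : ℚ)‖ ≤ (p : ℝ)⁻¹ := by
  have hp0 : (p : ℚ_[p]) ≠ 0 := by exact_mod_cast hp.out.ne_zero
  have hpR : (0 : ℝ) < p := by exact_mod_cast hp.out.pos
  set k := (-u.valuation).toNat with hk
  set x : ℤ_[p] := ⟨(p : ℚ_[p]) ^ k * u, norm_prime_pow_mul_le_one u⟩ with hx
  have h := (PadicInt.norm_le_pow_iff_mem_span_pow _ _).2 (PadicInt.appr_spec (k + 1) x)
  rw [PadicInt.norm_def, PadicInt.coe_sub, PadicInt.coe_natCast] at h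
  have h2 : u - (padicFloor u : ℚ) =
      ((p : ℚ_[p]) ^ k)⁻¹ * ((x : ℚ_[p]) - (x.appr (k + 1) : ℚ_[p])) := by
    have h3 : u = ((p : ℚ_[p]) ^ k)⁻¹ * x := by
      rw [hx, inv_mul_cancel_left₀ (pow_ne_zero _ hp0)]
    rw [mul_sub, ← h3, padicFloor, Rat.cast_div, div_eq_inv_mul]
    push_cast
    rfl
  rw [h2, norm_mul, norm_inv, norm_pow, Padic.norm_p, inv_pow, inv_inv]
  calc (p : ℝ) ^ k * _ ≤ (p : ℝ) ^ k * (p : ℝ) ^ (-((k + 1 : ℕ) : ℤ)) := by gcongr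
    _ = (p : ℝ)⁻¹ := by
      rw [zpow_neg, zpow_natCast, pow_succ]
      field_simp

section bApprox

variable {p : ℕ} [Fact p.Prime] {K : Type*} [Field K] (σinf : K →+* ℝ) (σp : K →+* ℚ_[p])

theorem exists_pow_mul_bApprox (s : ℕ) (α : K) :
    ∃ k : ℕ, ∃ m : ℤ, (p : ℚ) ^ k * bApprox σinf σp s α = m := by
  have hp0 : (p : ℚ) ≠ 0 := by exact_mod_cast (Fact.out : p.Prime).ne_zero
  refine ⟨(-(σp α).valuation).toNat, p ^ (-(σp α).valuation).toNat *
    (nearestIndex s (σinf α - (padicFloor (σp α) : ℝ)) * s) + PadicInt.appr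
      (⟨(p : ℚ_[p]) ^ (-(σp α).valuation).toNat * σp α, norm_prime_pow_mul_le_one _⟩ : ℤ_[p])
      ((-(σp α).valuation).toNat + 1), ?_⟩
  rw [bApprox, mul_add, padicFloor, mul_div_cancel₀ _ (pow_ne_zero _ hp0)]
  push_cast
  rfl

theorem abs_sub_bApprox_le {s : ℕ} (hs : 0 < s) (α : K) :
    |σinf α - bApprox σinf σp s α| ≤ s / 2 := by
  have h := abs_sub_nearestIndex_mul_le hs (σinf α - (padicFloor (σp α) : ℝ))
  rw [bApprox]
  push_cast
  rwa [add_comm, ← sub_sub]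

theorem norm_sub_bApprox_le (s : ℕ) (α : K) :
    ‖σp α - bApprox σinf σp s α‖ ≤ max (p : ℝ)⁻¹ ‖(s : ℚ_[p])‖ := by
  rw [bApprox]
  push_cast
  rw [add_comm, ← sub_sub]
  rw [sub_eq_add_neg _ ((_ : ℚ_[p]) * _)]
  refine (Padic.nonarchimedean _ _).trans (max_le_max (norm_sub_padicFloor_le _) ?_)
  rw [norm_neg, norm_mul]
  exact mul_le_of_le_one_left (norm_nonneg _) (Padic.norm_int_le_one _)

end bApprox

theorem spacing_pos (n : ℕ) : 0 < spacing 2 n := by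
  unfold spacing
  split_ifs <;> norm_num

theorem spacing_mul_spacing_succ (n : ℕ) : spacing 2 n * spacing 2 (n + 1) = 2 := by
  by_cases h : Even n <;> simp [spacing, h, Nat.even_add_one]

/-- A larger real error is allowed only at the even steps, where the remainder lies in `2 ℤ_2`. -/
theorem abs_mul_norm_sub_bApprox_lt {K : Type*} [Field K] (σinf : K →+* ℝ) (σ2 : K →+* ℚ_[2])
    (n : ℕ) (α : K) :
    |σinf α - bApprox σinf σ2 (spacing 2 n) α| * ‖σ2 α - bApprox σinf σ2 (spacing 2 n) α‖ < 1 := by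
  have h1 := abs_sub_bApprox_le σinf σ2 (spacing_pos n) α
  have h2 := norm_sub_bApprox_le σinf σ2 (spacing 2 n) α
  refine (mul_le_mul h1 h2 (norm_nonneg _) (by positivity)).trans_lt ?_
  have h3 : ‖(2 : ℚ_[2])‖ = 2⁻¹ := by simpa using Padic.norm_p (p := 2)
  by_cases h : Even n <;> simp only [spacing, h, if_true, if_false] <;> norm_num [h3]

/-- Consecutive complete quotients satisfy `|z_{n+1}| ≥ 2 / s_n` for `s_n = spacing 2 n`, and
`s_n s_{n+1} = 2`. -/
theorem two_le_abs_mul_of_abs_sub_le {z : ℕ → ℝ} {b : ℕ → ℚ} {n : ℕ}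
    (h0 : z (n + 1) * (z n - b n) = 1) (h1 : z (n + 2) * (z (n + 1) - b (n + 1)) = 1)
    (hb0 : |z n - b n| ≤ (spacing 2 n : ℝ) / 2)
    (hb1 : |z (n + 1) - b (n + 1)| ≤ (spacing 2 (n + 1) : ℝ) / 2) :
    2 ≤ |z (n + 1) * z (n + 2)| := by
  have hs : (spacing 2 n : ℝ) * spacing 2 (n + 1) = 2 := by
    exact_mod_cast spacing_mul_spacing_succ n
  have h : |z (n + 1) * z (n + 2)| * (|z n - b n| * |z (n + 1) - b (n + 1)|) = 1 := by
    rw [← abs_mul, ← abs_mul, show z (n + 1) * z (n + 2) * ((z n - b n) * (z (n + 1) - b (n + 1))) =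
      (z (n + 1) * (z n - b n)) * (z (n + 2) * (z (n + 1) - b (n + 1))) by ring, h0, h1]
    simp
  have h2 := mul_le_mul hb0 hb1 (abs_nonneg _) (by positivity)
  have h3 := mul_le_mul_of_nonneg_left h2 (abs_nonneg (z (n + 1) * z (n + 2)))
  rw [h, show (spacing 2 n : ℝ) / 2 * (spacing 2 (n + 1) / 2) = 1 / 2 by
    linear_combination hs / 4] at h3
  linarith

/-! ### Termination on the rational numbers -/

/-- The odd part of the numerator of `r` is `|r|` times `‖r‖` times the odd part of the denominator.
If `|r| * ‖r‖ < 1`, the odd part of the denominator therefore decreases from `r` to `r⁻¹`. The integer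
`d` may be any multiple of the odd part of the denominator of `r`. -/
theorem exists_lt_mul_pow_mul_inv_eq_int {r : ℚ} (hr : r ≠ 0)
    (hlt : |(r : ℝ)| * ‖(r : ℚ_[2])‖ < 1) {d : ℕ} (hd : 0 < d)
    (h : ∃ k : ℕ, ∃ m : ℤ, (d : ℚ) * 2 ^ k * r = m) :
    ∃ d' < d, 0 < d' ∧ ∃ k : ℕ, ∃ m : ℤ, (d' : ℚ) * 2 ^ k * r⁻¹ = m := by
  obtain ⟨k, m, hm⟩ := h
  have hdQ : (d : ℚ) ≠ 0 := by exact_mod_cast hd.ne'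
  have hm0 : m ≠ 0 := by
    rintro rfl
    simp [hr, hdQ] at hm
  obtain ⟨e, t, ht, hmt⟩ :=
    Nat.exists_eq_pow_mul_and_not_dvd (Int.natAbs_ne_zero.2 hm0) 2 (by norm_num)
  have ht0 : 0 < t := Nat.pos_of_ne_zero fun h0 => ht (h0 ▸ dvd_zero 2)
  -- `m = u * 2 ^ e * t` with a sign `u`.
  obtain ⟨u, hu, hmu⟩ : ∃ u : ℤ, (u = 1 ∨ u = -1) ∧ m = u * (2 ^ e * t) := by
    rcases Int.natAbs_eq m with h1 | h1
    · exact ⟨1, Or.inl rfl, by rw [h1, hmt]; push_cast; ring⟩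
    · exact ⟨-1, Or.inr rfl, by rw [h1, hmt]; push_cast; ring⟩
  have huu : (u : ℚ) * u = 1 := by rcases hu with rfl | rfl <;> norm_num
  have hr' : (d : ℚ) * 2 ^ k * r = u * (2 ^ e * t) := by rw [hm, hmu]; push_cast; ring
  refine ⟨t, ?_, ht0, e, u * (d * 2 ^ k), ?_⟩
  · have hR : (d : ℝ) * 2 ^ k * |(r : ℝ)| = 2 ^ e * t := by
      have h1 := congrArg (fun q : ℚ => |(q : ℝ)|) hr'
      push_cast at h1
      simp only [abs_mul, abs_pow, Nat.abs_cast, Nat.abs_ofNat] at h1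
      rw [h1]
      rcases hu with rfl | rfl <;> simp
    have h2 : ‖(2 : ℚ_[2])‖ = 2⁻¹ := by simpa using Padic.norm_p (p := 2)
    have hP : ‖(d : ℚ_[2])‖ * (2⁻¹ ^ k * ‖(r : ℚ_[2])‖) = 2⁻¹ ^ e := by
      have h1 := congrArg (fun q : ℚ => ‖(q : ℚ_[2])‖) hr'
      push_cast at h1
      have ht1 : ‖(t : ℚ_[2])‖ = 1 := by
        rw [Padic.norm_natCast_eq_one_iff]
        exact (Nat.Prime.coprime_iff_not_dvd Nat.prime_two).2 ht
      simp only [norm_mul, norm_pow, h2, ht1] at h1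
      rw [← mul_assoc, h1]
      rcases hu with rfl | rfl <;> simp
    have hP' : (2⁻¹ : ℝ) ^ e ≤ 2⁻¹ ^ k * ‖(r : ℚ_[2])‖ := by
      rw [← hP]
      exact mul_le_of_le_one_left (by positivity) (by simpa using Padic.norm_int_le_one (p := 2) d)
    have hdR : (0 : ℝ) < d := by exact_mod_cast hd
    have : (t : ℝ) < d := by
      calc (t : ℝ) = 2⁻¹ ^ e * (2 ^ e * t) := by
            rw [← mul_assoc, ← mul_pow]; norm_num
        _ = 2⁻¹ ^ e * (d * 2 ^ k * |(r : ℝ)|) := by rw [hR]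
        _ ≤ 2⁻¹ ^ k * ‖(r : ℚ_[2])‖ * (d * 2 ^ k * |(r : ℝ)|) := by gcongr
        _ = (2⁻¹ * 2) ^ k * d * (|(r : ℝ)| * ‖(r : ℚ_[2])‖) := by rw [mul_pow]; ring
        _ = d * (|(r : ℝ)| * ‖(r : ℚ_[2])‖) := by norm_num
        _ < d := mul_lt_of_lt_one_right hdR hlt
    exact_mod_cast this
  · push_cast
    rw [mul_inv_eq_iff_eq_mul₀ hr, mul_assoc, hr']
    linear_combination (-(2 ^ e * t : ℚ)) * huu

section Algorithms

variable {K : Type*} [Field K] [CharZero K] (σinf : K →+* ℝ) (σ2 : K →+* ℚ_[2])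

/-- Induction on `d`, a multiple of the odd part of the denominator of the complete quotient; a step
of Algorithm 1 that does not halt allows a smaller `d`. -/
theorem exists_alg1Seq_eq_alg1Quot (α : K) (d : ℕ) : ∀ (n : ℕ) (x : ℚ), 0 < d →
    alg1Seq σinf σ2 α n = x → (∃ k : ℕ, ∃ m : ℤ, (d : ℚ) * 2 ^ k * x = m) →
    ∃ N, alg1Seq σinf σ2 α N = (alg1Quot σinf σ2 α N : K) := by
  induction d using Nat.strong_induction_on with
  | _ d ih =>
    intro n x hd hx ⟨k, m, hm⟩
    by_cases hb : alg1Seq σinf σ2 α n = (alg1Quot σinf σ2 α n : K)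
    · exact ⟨n, hb⟩
    have hr : x - alg1Quot σinf σ2 α n ≠ 0 := by
      rw [hx] at hb
      exact sub_ne_zero.2 fun h => hb (congrArg _ h)
    have hlt := abs_mul_norm_sub_bApprox_lt σinf σ2 n (alg1Seq σinf σ2 α n)
    change |_ - ((alg1Quot σinf σ2 α n : ℚ) : ℝ)| * ‖_ - ((alg1Quot σinf σ2 α n : ℚ) : ℚ_[2])‖ < 1
      at hlt
    rw [hx, map_ratCast, map_ratCast, ← Rat.cast_sub, ← Rat.cast_sub] at hlt
    obtain ⟨j, c, hc⟩ := exists_pow_mul_bApprox σinf σ2 (spacing 2 n) (alg1Seq σinf σ2 α n)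
    change _ * alg1Quot σinf σ2 α n = _ at hc
    obtain ⟨d', hd'd, hd', h⟩ := exists_lt_mul_pow_mul_inv_eq_int hr hlt hd
      ⟨k + j, 2 ^ j * m - d * 2 ^ k * c, by
        push_cast at hc ⊢
        rw [← hm, ← hc]
        ring⟩
    refine ih d' hd'd (n + 1) _ hd' ?_ h
    rw [alg1Seq, hx, Rat.cast_inv, Rat.cast_sub, one_div, alg1Quot, hx]

theorem exists_alg1HaltsAt (x : ℚ) : ∃ N, Alg1HaltsAt σinf σ2 (x : K) N := by
  classical
  have h := exists_alg1Seq_eq_alg1Quot σinf σ2 (x : K) x.den 0 x x.den_pos rfl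
    ⟨0, x.num, by rw [pow_zero, mul_one, mul_comm, Rat.mul_den_eq_num]⟩
  exact ⟨Nat.find h, fun n hn => Nat.find_min h hn, Nat.find_spec h⟩

/-! ### Complete quotients of the two algorithms -/

theorem alg1Seq_succ_mul_sub {α : K} {n : ℕ}
    (h : alg1Seq σinf σ2 α n ≠ (alg1Quot σinf σ2 α n : K)) :
    σinf (alg1Seq σinf σ2 α (n + 1)) * (σinf (alg1Seq σinf σ2 α n) - alg1Quot σinf σ2 α n) = 1 := by
  rw [← map_ratCast σinf, ← map_sub, ← map_mul, alg1Seq]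
  change σinf (1 / (_ - (alg1Quot σinf σ2 α n : K)) * _) = 1
  rw [one_div_mul_cancel (sub_ne_zero.2 h), map_one]

theorem two_le_abs_alg1Seq_mul {α : K} {n : ℕ}
    (h0 : alg1Seq σinf σ2 α n ≠ (alg1Quot σinf σ2 α n : K))
    (h1 : alg1Seq σinf σ2 α (n + 1) ≠ (alg1Quot σinf σ2 α (n + 1) : K)) :
    2 ≤ |σinf (alg1Seq σinf σ2 α (n + 1)) * σinf (alg1Seq σinf σ2 α (n + 2))| :=
  two_le_abs_mul_of_abs_sub_le (z := fun n => σinf (alg1Seq σinf σ2 α n))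
    (b := alg1Quot σinf σ2 α) (alg1Seq_succ_mul_sub σinf σ2 h0) (alg1Seq_succ_mul_sub σinf σ2 h1)
    (abs_sub_bApprox_le σinf σ2 (spacing_pos n) _)
    (abs_sub_bApprox_le σinf σ2 (spacing_pos (n + 1)) _)

theorem alg1Seq_irrational {α : K} (hα : ∀ x : ℚ, (x : K) ≠ α) (n : ℕ) :
    ∀ x : ℚ, (x : K) ≠ alg1Seq σinf σ2 α n := by
  induction n with
  | zero => exact hα
  | succ n ih =>
    intro x hx
    refine ih (x⁻¹ + alg1Quot σinf σ2 α n) ?_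
    rw [Rat.cast_add, Rat.cast_inv, hx, alg1Seq, one_div, inv_inv]
    exact sub_add_cancel _ _

theorem alg2Seq_irrational {α : K} (hα : ∀ x : ℚ, (x : K) ≠ α) (n : ℕ) :
    ∀ x : ℚ, (x : K) ≠ alg2Seq σinf σ2 α (n + 1) := by
  induction n with
  | zero => exact hα
  | succ n ih =>
    intro x hx
    refine ih (x + alg2Quot σinf σ2 α (n + 1))⁻¹ ?_
    rw [Rat.cast_inv, Rat.cast_add, hx, alg2Seq, alg2Quot, sub_add_cancel, one_div, inv_inv]

/-- Algorithm 2 applied to `α` computes the expansion `α = 0 + 1 / (a_1 + 1 / (a_2 + ⋯))` with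
complete quotients `1 / α_(n)`. -/
theorem alg2_convergents {α : K} (h0 : ∀ n, alg2Seq σinf σ2 α (n + 1) ≠ 0) (hα : |σinf α| ≤ 1) :
    (∀ n, alg2Den σinf σ2 α n ≠ 0) ∧
      Tendsto (fun n => ((alg2Num σinf σ2 α n / alg2Den σinf σ2 α n : ℚ) : ℝ))
        atTop (𝓝 (σinf α)) := by
  set b := Function.update (alg2Quot σinf σ2 α) 0 0 with hb
  let z : ℕ → ℝ := fun n => n.casesOn (σinf α) fun n => σinf (1 / alg2Seq σinf σ2 α (n + 1))
  have hsub : ∀ n, z n - b n = σinf (alg2Seq σinf σ2 α (n + 1)) := by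
    intro n
    cases n with
    | zero => simp [z, hb, alg2Seq]
    | succ n => rw [alg2Seq, map_sub, map_ratCast]; rfl
  have hz : ∀ n, z (n + 1) * (z n - b n) = 1 := by
    intro n
    rw [hsub]
    change σinf _ * _ = 1
    rw [← map_mul, one_div_mul_cancel (h0 n), map_one]
  have hbd : ∀ n, |z n - b n| ≤ (spacing 2 n : ℝ) / 2 := by
    intro n
    cases n with
    | zero => simpa [hsub, alg2Seq, spacing] using hα
    | succ n => exact abs_sub_bApprox_le σinf σ2 (spacing_pos (n + 1)) _
  have hc : ∀ n, 2 ≤ |z (n + 1) * z (n + 2)| := fun n =>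
    two_le_abs_mul_of_abs_sub_le (hz n) (hz (n + 1)) (hbd n) (hbd (n + 1))
  simp only [alg2Den_eq, alg2Num_eq]
  exact ⟨fun n => cfDen_ne_zero (N := n + 1) (fun k _ => hz k) (fun k _ => hc k) n (by omega),
    tendsto_cf_convergents hz hc⟩

end Algorithms

theorem theorem3p17 {K : Type*} [Field K] [NumberField K] (hK : Module.finrank ℚ K = 2)
    (σinf : K →+* ℝ) (σ2 : K →+* ℚ_[2]) :
    (∀ α : K, α ∉ Set.range (algebraMap ℚ K) → PropertyI σinf σ2 α →
      (∀ n, 1 ≤ n → alg2Seq σinf σ2 α n ≠ 0) ∧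
      (∀ n, alg2Den σinf σ2 α n ≠ 0) ∧
      Tendsto (fun n => ((alg2Num σinf σ2 α n / alg2Den σinf σ2 α n : ℚ) : ℝ))
        atTop (𝓝 (σinf α))) ∧
    (∀ α : K, α ∉ Set.range (algebraMap ℚ K) →
      Alg1Infinite σinf σ2 α ∧
      (∀ n, alg1Den σinf σ2 α n ≠ 0) ∧
      Tendsto (fun n => ((alg1Num σinf σ2 α n / alg1Den σinf σ2 α n : ℚ) : ℝ))
        atTop (𝓝 (σinf α))) ∧
    (∀ α : K, α ∈ Set.range (algebraMap ℚ K) →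
      ∃ N, Alg1HaltsAt σinf σ2 α N ∧
        (∀ n ≤ N, alg1Den σinf σ2 α n ≠ 0) ∧
        ((alg1Num σinf σ2 α N / alg1Den σinf σ2 α N : ℚ) : ℝ) = σinf α) := by
  refine ⟨fun α hα hI => ?_, fun α hα => ?_, ?_⟩
  · have hα' : ∀ x : ℚ, (x : K) ≠ α := fun x hx => hα ⟨x, by rw [eq_ratCast, hx]⟩
    have h0 : ∀ n, alg2Seq σinf σ2 α (n + 1) ≠ 0 := fun n h =>
      alg2Seq_irrational σinf σ2 hα' n 0 (by rw [Rat.cast_zero, h])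
    refine ⟨fun n hn => ?_, alg2_convergents σinf σ2 h0 ?_⟩
    · obtain ⟨n, rfl⟩ := Nat.exists_eq_add_of_le' hn
      exact h0 n
    · have h := hI.1
      norm_num at h
      exact abs_le.2 ⟨h.1.le, h.2⟩
  · have hα' : ∀ x : ℚ, (x : K) ≠ α := fun x hx => hα ⟨x, by rw [eq_ratCast, hx]⟩
    have hne : Alg1Infinite σinf σ2 α := fun n h => alg1Seq_irrational σinf σ2 hα' n _ h.symm
    have hz := fun n => alg1Seq_succ_mul_sub σinf σ2 (hne n)
    have hc := fun n => two_le_abs_alg1Seq_mul σinf σ2 (hne n) (hne (n + 1))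
    simp only [alg1Den_eq, alg1Num_eq]
    exact ⟨hne, fun n => cfDen_ne_zero (z := fun n => σinf (alg1Seq σinf σ2 α n)) (N := n + 1)
      (fun k _ => hz k) (fun k _ => hc k) n (by omega),
      tendsto_cf_convergents (z := fun n => σinf (alg1Seq σinf σ2 α n)) hz hc⟩
  · rintro _ ⟨x, rfl⟩
    rw [eq_ratCast]
    obtain ⟨N, hN⟩ := exists_alg1HaltsAt σinf σ2 x
    have hz : ∀ n < N, _ := fun n hn => alg1Seq_succ_mul_sub σinf σ2 (hN.1 n hn)
    have hlast := cf_finite (z := fun n => σinf (alg1Seq σinf σ2 (x : K) n)) hz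
      (by rw [hN.2, map_ratCast])
    simp only [alg1Den_eq, alg1Num_eq]
    refine ⟨N, hN, fun n hn => ?_, hlast.2⟩
    rcases hn.lt_or_eq with h | rfl
    · exact cfDen_ne_zero (z := fun n => σinf (alg1Seq σinf σ2 (x : K) n)) hz
        (fun k hk => two_le_abs_alg1Seq_mul σinf σ2 (hN.1 k (by omega)) (hN.1 (k + 1) hk)) n h
    · exact hlast.1
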